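/- A bicoloured plane tree is a finite tree whose vertices are properly coloured black and white, together with a cyclic ordering of the edges around each vertex. It has passport $[\alpha;\beta;n]$ if it has $n$ edges, its black vertices have degrees $\alpha$ and its white vertices have degrees $\beta$. Label the edges by $1,\dots,n$, let $\sigma_0\in S_n$ (resp. $\sigma_1\in S_n$) be the permutation whose cycles are the cyclic orderings of the edges around the black (resp. white) vertices, and call $G=\langle\sigma_0,\sigma_1\rangle\le S_n$ the monodromy group of the tree. Let $r,s,p,n$ be natural numbers with $n=5p=2r+s$ and $p+s+2=n+1$. For every bicoloured plane tree with passport $[r^2,1^s;5^p;n]$ and every labelling of its edges, the monodromy group $G$ satisfies $$G\cong\begin{cases}A_p^5\rtimes\mathbb Z_5 & \text{if } r \text{ is odd},\\ A_p^5\rtimes(\mathbb Z_2^4\rtimes\mathbb Z_5) & \text{if } r\text{ is even.}\end{cases}$$ Here $\mathbb Z_5$ acts on $A_p^5$ by cyclically permuting the five coordinates. In the even case $\mathbb Z_2^4$ is identified with the group of vectors in $\mathbb Z_2^5$ with coordinate sum $0$, on which $\mathbb Z_5$ acts by cyclically permuting the coordinates, and a vector $(v_i)$ of it acts on $A_p^5$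 by conjugating the $i$-th coordinate by $\tau^{v_i}$, where $\tau\in S_p$ is a transposition. -/

import Mathlib

/-! ### Bicoloured plane trees, passports and monodromy groups -/

/-- A bicoloured plane tree on the vertex set `V`: a tree whose vertices are properly coloured black
and white, together with a cyclic ordering of the edges around every vertex.  The orderings around
the black (resp. white) vertices are recorded as the cycles of the permutation `σ₀` (resp. `σ₁`) of
the set of edges. -/
structure BicolouredPlaneTree (V : Type*) where
  graph : SimpleGraph V
  isTree : graph.IsTree
  IsBlack : V → Prop
  proper : ∀ u v, graph.Adj u v → (IsBlack u ↔ ¬ IsBlack v)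
  σ₀ : Equiv.Perm graph.edgeSet
  σ₁ : Equiv.Perm graph.edgeSet
  cyclic_black : ∀ v, IsBlack v → σ₀.IsCycleOn {e | v ∈ (e : Sym2 V)}
  cyclic_white : ∀ v, ¬ IsBlack v → σ₁.IsCycleOn {e | v ∈ (e : Sym2 V)}

namespace BicolouredPlaneTree

variable {V : Type*}

open Classical in
/-- The multiset of degrees of the black vertices. -/
noncomputable def blackDegrees [Fintype V] (T : BicolouredPlaneTree V) : Multiset ℕ :=
  (Finset.univ.filter fun v => T.IsBlack v).val.map fun v => T.graph.degree v

open Classical in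
/-- The multiset of degrees of the white vertices. -/
noncomputable def whiteDegrees [Fintype V] (T : BicolouredPlaneTree V) : Multiset ℕ :=
  (Finset.univ.filter fun v => ¬ T.IsBlack v).val.map fun v => T.graph.degree v

/-- `T` has passport `[α; β; n]`: it has `n` edges, the black vertices have degrees `α` and the
white vertices have degrees `β`. -/
def HasPassport [Fintype V] (T : BicolouredPlaneTree V) (α β : Multiset ℕ) (n : ℕ) : Prop :=
  T.blackDegrees = α ∧ T.whiteDegrees = β ∧ Nat.card T.graph.edgeSet = n

/-- The monodromy (cartographic) group `⟨σ₀, σ₁⟩ ≤ Sₙ` of `T`, for the labelling `l` of the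
edges. -/
def monodromyGroup (T : BicolouredPlaneTree V) {n : ℕ} (l : T.graph.edgeSet ≃ Fin n) :
    Subgroup (Equiv.Perm (Fin n)) :=
  Subgroup.closure {l.permCongr T.σ₀, l.permCongr T.σ₁}

end BicolouredPlaneTree

/-! ### The two semidirect products -/

/-- The cyclic group of order `2`, written multiplicatively. -/
abbrev Z2 : Type := Multiplicative (ZMod 2)

/-- The cyclic group of order `5`, written multiplicatively. -/
abbrev Z5 : Type := Multiplicative (ZMod 5)

/-- `M ^ 5`, with the coordinates indexed by `Z5`. -/
abbrev Pow5 (M : Type) : Type := Z5 → M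

/-- The action of `Z5` on `M ^ 5` by cyclic permutation of the coordinates:
`(cyclicShift M c f) i = f (c⁻¹ * i)`. -/
def cyclicShift (M : Type) [Group M] : Z5 →* MulAut (Pow5 M) := mulAutArrow

/-- The vectors in `Z2 ^ 5` whose coordinates multiply to `1`. -/
def evenVectors : Subgroup (Pow5 Z2) where
  carrier := {v | ∏ i, v i = 1}
  one_mem' := by simp
  mul_mem' := by
    intro a b ha hb
    simp only [Set.mem_ofPred_eq] at *
    simp [Finset.prod_mul_distrib, ha, hb]
  inv_mem' := by
    intro a ha
    simp only [Set.mem_ofPred_eq] at *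
    simp [ha]

theorem cyclicShift_mem_evenVectors (c : Z5) {v : Pow5 Z2} (hv : v ∈ evenVectors) :
    cyclicShift Z2 c v ∈ evenVectors := by
  change ∏ i, v (c⁻¹ * i) = 1
  rw [← hv]
  exact Equiv.prod_comp (Equiv.mulLeft c⁻¹) v

/-- The cyclic shift, on the even vectors. -/
def evenShift : Z5 →* MulAut evenVectors where
  toFun c :=
    { toFun := fun v => ⟨cyclicShift Z2 c v, cyclicShift_mem_evenVectors c v.2⟩
      invFun := fun v => ⟨cyclicShift Z2 c⁻¹ v, cyclicShift_mem_evenVectors c⁻¹ v.2⟩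
      left_inv := fun v => by ext1; simp
      right_inv := fun v => by ext1; simp
      map_mul' := fun v w => by ext1; simp }
  map_one' := by ext1 v; apply Subtype.ext; simp
  map_mul' c d := by ext1 v; apply Subtype.ext; simp

/-- The identification `Z2 ^ 4 ≃ evenVectors`, adding the product of the four entries as a fifth
one (note that `x⁻¹ = x` in `Z2`). -/
def evenEquiv : (Fin 4 → Z2) ≃* evenVectors where
  toFun v :=
    ⟨fun i => Fin.snoc (α := fun _ : Fin 5 => Z2) v (∏ j, v j) (Multiplicative.toAdd i : Fin 5), by
      revert v; change ∀ v, (∏ i : Z5, _) = (1 : Z2); decide⟩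
  invFun v j := v.1 (Multiplicative.ofAdd (j.castSucc : Fin 5))
  left_inv v := by
    funext j
    exact Fin.snoc_castSucc (α := fun _ : Fin 5 => Z2) (∏ j, v j) v j
  right_inv := by
    rintro ⟨v, hv⟩
    apply Subtype.ext
    change ∏ i, v i = 1 at hv
    funext i
    revert v i
    change ∀ v : Pow5 Z2, ∏ i, v i = 1 → ∀ i : Z5, (Fin.snoc (α := fun _ : Fin 5 => Z2)
      (fun j : Fin 4 => v (Multiplicative.ofAdd (j.castSucc : Fin 5)))
      (∏ j : Fin 4, v (Multiplicative.ofAdd (j.castSucc : Fin 5)))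
      (Multiplicative.toAdd i : Fin 5) : Z2) = v i
    decide +kernel
  map_mul' := by decide +kernel

/-- `Z5` acting on `Z2 ^ 4` by the cyclic shift of the even vectors. -/
def shiftZ2Pow4 : Z5 →* MulAut (Fin 4 → Z2) :=
  (MulAut.congr evenEquiv.symm).toMonoidHom.comp evenShift

/-- The group `Z2 ^ 4 ⋊ Z5`. -/
abbrev Z2Pow4Z5 : Type := (Fin 4 → Z2) ⋊[shiftZ2Pow4] Z5

/-- The homomorphism from `Z2` that sends the generator to the transposition `τ`. -/
def ofSwap {X : Type} [DecidableEq X] (τ : Equiv.Perm X) (hτ : τ.IsSwap) :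
    Z2 →* Equiv.Perm X where
  toFun x := τ ^ (Multiplicative.toAdd x).val
  map_one' := by simp
  map_mul' x y := by
    have h : τ * τ = 1 := by
      obtain ⟨a, b, -, rfl⟩ := hτ
      exact Equiv.swap_mul_self a b
    have key : ∀ m : ZMod 2, m = 0 ∨ m = 1 := by decide
    rcases key (Multiplicative.toAdd x) with hx | hx <;>
      rcases key (Multiplicative.toAdd y) with hy | hy <;>
      simp [toAdd_mul, hx, hy, ZMod.val_one, h, show (1 + 1 : ZMod 2) = 0 from rfl]

/-- `Z2 ^ 5` acting on `A_X ^ 5`: the generator of the `i`-th factor conjugates the `i`-th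
coordinate by the transposition `τ`. -/
def swapConj {X : Type} [Fintype X] [DecidableEq X] (τ : Equiv.Perm X) (hτ : τ.IsSwap) :
    Pow5 Z2 →* MulAut (Pow5 (alternatingGroup X)) where
  toFun v := MulEquiv.piCongrRight fun i => MulAut.conjNormal (ofSwap τ hτ (v i))
  map_one' := by ext1 f; funext i; simp
  map_mul' v w := by ext1 f; funext i; simp

/-- `Z2 ^ 4 ⋊ Z5` acting on `A_X ^ 5`: `Z2 ^ 4`, seen as the even vectors of `Z2 ^ 5`, acts through
conjugation of the coordinates by `τ`, and `Z5` permutes the coordinates cyclically. -/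
def swapAction {X : Type} [Fintype X] [DecidableEq X] (τ : Equiv.Perm X) (hτ : τ.IsSwap) :
    Z2Pow4Z5 →* MulAut (Pow5 (alternatingGroup X)) :=
  SemidirectProduct.lift
    ((swapConj τ hτ).comp (evenVectors.subtype.comp evenEquiv.toMonoidHom))
    (cyclicShift (alternatingGroup X))
    (by
      intro c
      ext1 v
      have h : (evenEquiv (shiftZ2Pow4 c v) : Pow5 Z2) = cyclicShift Z2 c (evenEquiv v) := by
        simp [shiftZ2Pow4, evenShift, MulAut.congr]
      ext1 f
      funext i
      simp only [MonoidHom.comp_apply, MulEquiv.coe_toMonoidHom, Subgroup.subtype_apply, h,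
        MulAut.conj_apply, MulAut.mul_apply, ← map_inv]
      change _ = MulAut.conjNormal (ofSwap τ hτ ((evenEquiv v : Pow5 Z2) (c⁻¹ * i)))
        (f ((c⁻¹)⁻¹ * (c⁻¹ * i)))
      rw [inv_mul_cancel_left]
      rfl)

/-! The numerical conditions force `p + 1 = 2 * r`. Each of the `p` white vertices is joined to one
of the two black hubs of degree `r`, since all other black vertices are leaves. The two
neighbourhoods have size `r` and cover `p = 2 * r - 1` white vertices, so they share exactly one,
`w` (`exists_twoTransversalCycles`).

Edges can then be labelled by pairs (white end, element of `Z5`) so that `σ₁` is the shift of the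
second coordinate and the edges at each hub lie on a single level, `1` or `κ ≠ 1`
(`exists_coordinates`). The group becomes a subgroup of the wreath product of `Equiv.Perm (Fin p)`
with `Z5`, generated by the shift and by a base element with entries `a` at `1` and `b` at `κ`. Here
`a` and `b` are `r`-cycles whose supports cover everything and meet in `w` (when `r = 1`, both are
trivial).

The commutator of the base element with its shift by `κ` lives in the single coordinate `κ`, where
it is the commutator of `a` and `b`: a 3-cycle if `r > 1`. Since `a` and `b` generate a primitive
group, Jordan's theorem and the simplicity of the alternating group put the whole alternating group
in that coordinate, and by shifting in all five (`inl_mem_twoEntriesClosure_of_alternating`). What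
remains are signs. For odd `r` both cycles are even and nothing more occurs. For even `r` both are
odd, and the shifts of the sign vector of the base element generate all sign vectors of product `1`
(`range_ofAltShift`, `range_ofAltSwap`). -/

open Equiv.Perm in
/-- Two permutations, cycles on `U` and on `V` and trivial elsewhere, where `U` and `V` cover
everything and share exactly the point `w`. -/
structure CyclesMeetingAt {X : Type*} (a b : Equiv.Perm X) (U V : Set X) (w : X) : Prop where
  left : a.IsCycleOn U
  right : b.IsCycleOn V
  left_fix : ∀ x ∉ U, a x = x
  right_fix : ∀ x ∉ V, b x = x
  cover : ∀ x, x ∈ U ∨ x ∈ V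
  inter : ∀ x, x ∈ U ∧ x ∈ V ↔ x = w

/-! ### Two cycles sharing one point: primitivity and the alternating group. -/

namespace CyclesMeetingAt

open MulAction Pointwise

variable {X : Type*} {a b : Equiv.Perm X} {U V : Set X} {w : X}

theorem symm (h : CyclesMeetingAt a b U V w) : CyclesMeetingAt b a V U w :=
  ⟨h.right, h.left, h.right_fix, h.left_fix, fun x => (h.cover x).symm,
    fun x => and_comm.trans (h.inter x)⟩

theorem mem_left (h : CyclesMeetingAt a b U V w) : w ∈ U := ((h.inter w).2 rfl).1

theorem mem_right (h : CyclesMeetingAt a b U V w) : w ∈ V := ((h.inter w).2 rfl).2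

/-- The products `a * b` and `b * a` agree except at `w` and its preimages under `a` and `b`, so the
commutator only moves `w`, `a w` and `b w`. -/
theorem isThreeCycle_commutator [Fintype X] [DecidableEq X] (h : CyclesMeetingAt a b U V w)
    (hU : U.Nontrivial) (hV : V.Nontrivial) : (a * b * a⁻¹ * b⁻¹).IsThreeCycle := by
  have hwU := h.mem_left
  have hwV := h.mem_right
  have haw : a w ≠ w := h.left.apply_ne hU hwU
  have hbw : b w ≠ w := h.right.apply_ne hV hwV
  have haU : ∀ x, a x ∈ U ↔ x ∈ U := fun x => h.left.apply_mem_iff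
  have hbV : ∀ x, b x ∈ V ↔ x ∈ V := fun x => h.right.apply_mem_iff
  have hi := h.inter
  have hc := h.cover
  have hfa := h.left_fix
  have hfb := h.right_fix
  have hab : a w ≠ b w := by grind
  have key : a * b * a⁻¹ * b⁻¹ = Equiv.swap w (b w) * Equiv.swap w (a w) := by
    rw [mul_inv_eq_iff_eq_mul, mul_inv_eq_iff_eq_mul]
    ext x
    simp only [Equiv.Perm.mul_apply, Equiv.swap_apply_def]
    have hia := a.injective
    have hib := b.injective
    have h1 : a x = a w ↔ x = w := hia.eq_iff
    have h2 : b x = b w ↔ x = w := hib.eq_iff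
    by_cases hx : x = w
    · subst hx
      have e1 : a (b x) = b x := by grind
      have e2 : b (a x) = a x := by grind
      rw [e1, e2]
      grind
    · by_cases hxU : x ∈ U
      · have e1 : b x = x := by grind
        rw [e1]
        by_cases hax : a x = w
        · rw [hax]; grind
        · have e2 : b (a x) = a x := by grind
          rw [e2]; grind
      · have e1 : a x = x := by grind
        rw [e1]
        by_cases hbx : b x = w
        · rw [hbx]; grind
        · have e2 : a (b x) = b x := by grind
          rw [e2]; grind
  rw [key]
  exact Equiv.Perm.isThreeCycle_swap_mul_swap_same hbw.symm haw.symm hab.symm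

theorem exists_smul_eq (h : CyclesMeetingAt a b U V w) (x : X) :
    ∃ g ∈ Subgroup.closure {a, b}, g w = x := by
  rcases h.cover x with hx | hx
  · obtain ⟨i, hi⟩ := h.left.2 h.mem_left hx
    exact ⟨a ^ i, zpow_mem (Subgroup.subset_closure (by simp)) i, hi⟩
  · obtain ⟨i, hi⟩ := h.right.2 h.mem_right hx
    exact ⟨b ^ i, zpow_mem (Subgroup.subset_closure (by simp)) i, hi⟩

/-- A block through `w` that meets `U` in a second point contains `V`. -/
theorem subset_of_isBlock (h : CyclesMeetingAt a b U V w) {B : Set X}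
    (hB : IsBlock (Subgroup.closure {a, b}) B) (hw : w ∈ B) {y : X} (hy : y ∈ B) (hyw : y ≠ w)
    (hyU : y ∈ U) : V ⊆ B := by
  intro x hx
  have hbm : b ∈ Subgroup.closure {a, b} := Subgroup.subset_closure (by simp)
  have hyV : y ∉ V := fun hyV => hyw ((h.inter y).1 ⟨hyU, hyV⟩)
  obtain ⟨i, hi⟩ := h.right.2 h.mem_right hx
  -- This power of `b` carries `w` to `x` but fixes `y`, which lies outside `V`; hence it preserves
  -- the block.
  set g : Subgroup.closure {a, b} := ⟨b, hbm⟩ ^ i with hg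
  have hgy : g • y = y := by
    change (b ^ i) y = y
    exact Function.IsFixedPt.perm_zpow (h.right_fix y hyV) i
  have hgB : g • B = B := by
    apply hB.smul_eq_of_mem hy
    rwa [hgy]
  rw [← hgB, ← hi]
  exact ⟨w, hw, rfl⟩

/-- A block containing `w` and a second point of one cycle swallows the other cycle, and thereby
also the first. -/
theorem isPreprimitive (h : CyclesMeetingAt a b U V w) (hU : U.Nontrivial) (hV : V.Nontrivial) :
    IsPreprimitive (Subgroup.closure {a, b}) X := by
  have : IsPretransitive (Subgroup.closure {a, b}) X := by
    rw [isPretransitive_iff_base w]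
    intro x
    obtain ⟨g, hg, hx⟩ := h.exists_smul_eq x
    exact ⟨⟨g, hg⟩, hx⟩
  refine IsPreprimitive.of_isTrivialBlock_base w fun {B} hw hB => ?_
  rw [IsTrivialBlock, or_iff_not_imp_left, Set.not_subsingleton_iff]
  intro hnt
  obtain ⟨y, hy, hyw⟩ := hnt.exists_ne w
  have hB' : IsBlock (Subgroup.closure {b, a}) B := by rwa [Set.pair_comm]
  have key : U ⊆ B ∧ V ⊆ B := by
    rcases h.cover y with hyU | hyV
    · have hVB := h.subset_of_isBlock hB hw hy hyw hyU
      obtain ⟨z, hz, hzw⟩ := hV.exists_ne w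
      exact ⟨h.symm.subset_of_isBlock hB' hw (hVB hz) hzw hz, hVB⟩
    · have hUB := h.symm.subset_of_isBlock hB' hw hy hyw hyV
      obtain ⟨z, hz, hzw⟩ := hU.exists_ne w
      exact ⟨hUB, h.subset_of_isBlock hB hw (hUB hz) hzw hz⟩
  exact Set.eq_univ_of_forall fun x => (h.cover x).elim (fun hx => key.1 hx) fun hx => key.2 hx

theorem alternatingGroup_le_closure [Fintype X] [DecidableEq X] (h : CyclesMeetingAt a b U V w)
    (hU : U.Nontrivial) (hV : V.Nontrivial) : alternatingGroup X ≤ Subgroup.closure {a, b} := by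
  refine Equiv.Perm.alternatingGroup_le_of_isPreprimitive_of_isThreeCycle_mem
    (h.isPreprimitive hU hV) (h.isThreeCycle_commutator hU hV) ?_
  have ha : a ∈ Subgroup.closure {a, b} := Subgroup.subset_closure (by simp)
  have hb : b ∈ Subgroup.closure {a, b} := Subgroup.subset_closure (by simp)
  exact mul_mem (mul_mem (mul_mem ha hb) (inv_mem ha)) (inv_mem hb)

/-- A subgroup normalized by the two cycles that contains their commutator contains the
alternating group. -/
theorem alternatingGroup_le [Fintype X] [DecidableEq X] (h : CyclesMeetingAt a b U V w)
    (hU : U.Nontrivial) (hV : V.Nontrivial) (hX : Odd (Nat.card X)) {K : Subgroup (Equiv.Perm X)}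
    (ha : ∀ g ∈ K, a * g * a⁻¹ ∈ K) (hb : ∀ g ∈ K, b * g * b⁻¹ ∈ K)
    (hK : a * b * a⁻¹ * b⁻¹ ∈ K) : alternatingGroup X ≤ K := by
  have h3 := h.isThreeCycle_commutator hU hV
  set c := a * b * a⁻¹ * b⁻¹
  have hcard : 3 ≤ Nat.card X := by
    have := Finset.card_le_univ c.support
    rwa [h3.card_support, ← Nat.card_eq_fintype_card] at this
  have hnt : Nontrivial X := by
    rw [← Finite.one_lt_card_iff_nontrivial]
    omega
  -- Simplicity is available from degree 5 on. Oddness rules out degree 4, and in degree 3 the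
  -- commutator alone generates the alternating group.
  by_cases h5 : 5 ≤ Nat.card X
  · have hnorm : Subgroup.closure {a, b} ≤ Subgroup.normalizer (K : Set (Equiv.Perm X)) := by
      rw [Subgroup.closure_le]
      have : ∀ d : Equiv.Perm X, (∀ g ∈ K, d * g * d⁻¹ ∈ K) →
          d ∈ Subgroup.normalizer (K : Set (Equiv.Perm X)) := fun d hd =>
        Subgroup.mem_normalizer_fintype hd
      rintro d (rfl | rfl)
      exacts [this _ ha, this _ hb]
    have hA := (h.alternatingGroup_le_closure hU hV).trans hnorm
    have hnormal : (K.subgroupOf (alternatingGroup X)).Normal :=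
      ⟨fun n hn g => (Subgroup.mem_normalizer_iff.1 (hA g.2) n.1).1 hn⟩
    have := alternatingGroup.isSimpleGroup h5
    refine Subgroup.subgroupOf_eq_top.1 (hnormal.eq_bot_or_eq_top.resolve_left fun hbot => ?_)
    have hc : (⟨c, h3.mem_alternatingGroup⟩ : alternatingGroup X) ∈
        K.subgroupOf (alternatingGroup X) := hK
    rw [hbot, Subgroup.mem_bot] at hc
    exact h3.ne_one (congrArg Subtype.val hc)
  · have hc3 : Nat.card X = 3 := by
      obtain ⟨k, hk⟩ := hX
      omega
    have hle : Subgroup.zpowers c ≤ alternatingGroup X := by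
      rw [Subgroup.zpowers_le]
      exact h3.mem_alternatingGroup
    have : Subgroup.zpowers c = alternatingGroup X := by
      apply Subgroup.eq_of_le_of_card_ge hle
      rw [Nat.card_zpowers, h3.orderOf, nat_card_alternatingGroup, hc3]
      decide
    rw [← this, Subgroup.zpowers_le]
    exact hK

/-- The sign of a permutation that is a cycle on `U` and trivial elsewhere. -/
theorem _root_.Equiv.Perm.IsCycleOn.sign_eq [Fintype X] [DecidableEq X] {U : Finset X}
    (h : a.IsCycleOn U) (hU : U.Nonempty) (hf : ∀ x ∉ U, a x = x) :
    Equiv.Perm.sign a = -(-1) ^ U.card := by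
  by_cases hnt : U.Nontrivial
  · have hs : a.support = U := by
      ext x
      rw [Equiv.Perm.mem_support]
      exact ⟨fun hx => by_contra fun hxU => hx (hf x hxU), fun hx => h.apply_ne hnt hx⟩
    have hc : a.IsCycle := by
      rw [Equiv.Perm.isCycle_iff_exists_isCycleOn]
      exact ⟨U, hnt, h, fun x hx => by_contra fun hxU => hx (hf x hxU)⟩
    rw [hc.sign, hs]
  · obtain ⟨x, rfl⟩ := hU.exists_eq_singleton_or_nontrivial.resolve_right hnt
    have : a = 1 := by
      ext y
      by_cases hy : y = x
      · subst hy
        simpa using h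
      · exact hf y (by simpa using hy)
    simp [this]

end CyclesMeetingAt

/-! ### The wreath product with `Z5` -/

/-- The wreath product of `M` with the regular permutation group `Z5`. -/
abbrev Wreath5 (M : Type) [Group M] : Type := Pow5 M ⋊[cyclicShift M] Z5

namespace Wreath5

open SemidirectProduct

variable {M : Type} [Group M]

theorem cyclicShift_apply (c : Z5) (f : Pow5 M) (i : Z5) : cyclicShift M c f i = f (c⁻¹ * i) := rfl

theorem cyclicShift_mulSingle (c i : Z5) (x : M) :
    cyclicShift M c (Pi.mulSingle i x) = Pi.mulSingle (c * i) x := by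
  funext j
  rw [cyclicShift_apply, Pi.mulSingle_apply, Pi.mulSingle_apply]
  simp only [inv_mul_eq_iff_eq_mul]

/-- The action of a wreath product of permutation groups on the product set. -/
def toPerm (X : Type) : Wreath5 (Equiv.Perm X) →* Equiv.Perm (X × Z5) where
  toFun g :=
    { toFun := fun y => (g.left (g.right * y.2) y.1, g.right * y.2)
      invFun := fun y => ((g.left y.2)⁻¹ y.1, g.right⁻¹ * y.2)
      left_inv := fun y => by simp
      right_inv := fun y => by simp }
  map_one' := by ext1 y; simp
  map_mul' g h := by
    ext1 y
    simp [cyclicShift_apply, mul_assoc]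

theorem toPerm_apply {X : Type} (g : Wreath5 (Equiv.Perm X)) (y : X × Z5) :
    toPerm X g y = (g.left (g.right * y.2) y.1, g.right * y.2) := rfl

theorem toPerm_injective (X : Type) [Nonempty X] : Function.Injective (toPerm X) := by
  rw [injective_iff_map_eq_one]
  intro g hg
  have h : ∀ y : X × Z5, (g.left (g.right * y.2) y.1, g.right * y.2) = y := fun y => by
    rw [← toPerm_apply, hg, Equiv.Perm.one_apply]
  have hr : g.right = 1 := by
    have := congrArg Prod.snd (h (Classical.arbitrary X, 1))
    simpa using this
  ext1
  · funext i
    ext x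
    have := congrArg Prod.fst (h (x, i))
    simpa [hr] using this
  · exact hr

/-- The element of the base group with entries `a` at `1` and `b` at `κ`. -/
def twoEntries (a b : M) (κ : Z5) : Pow5 M := Pi.mulSingle 1 a * Pi.mulSingle κ b

/-- The subgroup generated by `twoEntries a b κ` and the generator of `Z5`. -/
def twoEntriesClosure (a b : M) (κ : Z5) : Subgroup (Wreath5 M) :=
  Subgroup.closure {inl (twoEntries a b κ), inr (Multiplicative.ofAdd 1)}

variable {a b : M} {κ : Z5}

theorem inr_mem_twoEntriesClosure (c : Z5) : inr c ∈ twoEntriesClosure a b κ := by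
  have h : inr (Multiplicative.ofAdd 1) ∈ twoEntriesClosure a b κ :=
    Subgroup.subset_closure (by simp)
  have hc : c = Multiplicative.ofAdd 1 ^ (Multiplicative.toAdd c).val := by
    revert c; decide
  rw [hc, map_pow]
  exact pow_mem h _

theorem inl_twoEntries_mem : inl (twoEntries a b κ) ∈ twoEntriesClosure a b κ :=
  Subgroup.subset_closure (by simp)

theorem inl_cyclicShift_mem (c : Z5) {f : Pow5 M} (hf : inl f ∈ twoEntriesClosure a b κ) :
    inl (cyclicShift M c f) ∈ twoEntriesClosure a b κ := by
  rw [inl_aut]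
  exact mul_mem (mul_mem (inr_mem_twoEntriesClosure c) hf) (inr_mem_twoEntriesClosure c⁻¹)

theorem cyclicShift_twoEntries (c : Z5) :
    cyclicShift M c (twoEntries a b κ) = Pi.mulSingle c a * Pi.mulSingle (c * κ) b := by
  simp [twoEntries, cyclicShift_mulSingle]

theorem mulSingle_conj {f : Pow5 M} (i : Z5) (g : M) :
    f * Pi.mulSingle i g * f⁻¹ = Pi.mulSingle i (f i * g * (f i)⁻¹) := by
  funext j
  rcases eq_or_ne j i with rfl | hj
  · simp
  · simp [hj]

theorem twoEntries_apply_right (hκ : κ ≠ 1) : twoEntries a b κ κ = b := by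
  simp [twoEntries, hκ]

theorem cyclicShift_twoEntries_apply (hκ : κ ≠ 1) :
    cyclicShift M κ (twoEntries a b κ) κ = a := by
  have : κ ≠ κ * κ := by simpa using hκ
  simp [cyclicShift_twoEntries, this]

/-- The two factors are supported on `{κ, κ * κ}` and `{1, κ}`. As `Z5` has odd order, `κ * κ ≠ 1`,
so they overlap only at `κ`, with entries `a` and `b`. -/
theorem commutator_twoEntries (hκ : κ ≠ 1) :
    cyclicShift M κ (twoEntries a b κ) * twoEntries a b κ *
      (cyclicShift M κ (twoEntries a b κ))⁻¹ * (twoEntries a b κ)⁻¹ =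
      Pi.mulSingle κ (a * b * a⁻¹ * b⁻¹) := by
  funext j
  rcases eq_or_ne j κ with rfl | hj
  · simp [twoEntries_apply_right hκ, cyclicShift_twoEntries_apply hκ]
  · have h1 : κ * κ ≠ 1 := (by decide : ∀ κ : Z5, κ ≠ 1 → κ * κ ≠ 1) κ hκ
    rcases eq_or_ne j 1 with rfl | hj1
    · simp [cyclicShift_twoEntries, hj, h1.symm]
    · simp [twoEntries, hj, hj1]

/-- `hK` is applied to the group of all `g` for which the vector with sole entry `g` at `κ` lies in
the closure. On that coordinate, conjugation by `twoEntries` is conjugation by `b`, and conjugation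
by its `κ`-shift is conjugation by `a`. -/
theorem inl_mem_twoEntriesClosure_of_alternating {X : Type} [Fintype X] [DecidableEq X]
    {a b : Equiv.Perm X} (hκ : κ ≠ 1)
    (hK : ∀ K : Subgroup (Equiv.Perm X), (∀ g ∈ K, a * g * a⁻¹ ∈ K) → (∀ g ∈ K, b * g * b⁻¹ ∈ K) →
      a * b * a⁻¹ * b⁻¹ ∈ K → alternatingGroup X ≤ K)
    (f : Pow5 (Equiv.Perm X)) (hf : ∀ i, f i ∈ alternatingGroup X) :
    inl f ∈ twoEntriesClosure a b κ := by
  have h0 := inl_twoEntries_mem (a := a) (b := b) (κ := κ)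
  have h1 := inl_cyclicShift_mem κ h0
  have hA : alternatingGroup X ≤ ((twoEntriesClosure a b κ).comap inl).comap
      (MonoidHom.mulSingle (fun _ : Z5 => Equiv.Perm X) κ) := by
    apply hK
    · intro g hg
      change inl (Pi.mulSingle κ g : Pow5 (Equiv.Perm X)) ∈
        twoEntriesClosure a b κ at hg
      change inl (Pi.mulSingle κ (a * g * a⁻¹) : Pow5 (Equiv.Perm X)) ∈
        twoEntriesClosure a b κ
      have := mulSingle_conj (f := cyclicShift _ κ (twoEntries a b κ)) κ g
      rw [cyclicShift_twoEntries_apply hκ] at this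
      rw [← this, map_mul, map_mul, map_inv]
      exact mul_mem (mul_mem h1 hg) (inv_mem h1)
    · intro g hg
      change inl (Pi.mulSingle κ g : Pow5 (Equiv.Perm X)) ∈
        twoEntriesClosure a b κ at hg
      change inl (Pi.mulSingle κ (b * g * b⁻¹) : Pow5 (Equiv.Perm X)) ∈
        twoEntriesClosure a b κ
      have := mulSingle_conj (f := twoEntries a b κ) κ g
      rw [twoEntries_apply_right hκ] at this
      rw [← this, map_mul, map_mul, map_inv]
      exact mul_mem (mul_mem h0 hg) (inv_mem h0)
    · change inl (Pi.mulSingle κ (a * b * a⁻¹ * b⁻¹) : Pow5 (Equiv.Perm X)) ∈ twoEntriesClosure a b κ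
      rw [← commutator_twoEntries hκ]
      simp only [map_mul inl, map_inv inl]
      exact mul_mem (mul_mem (mul_mem h1 h0) (inv_mem h1)) (inv_mem h0)
  change f ∈ (twoEntriesClosure a b κ).comap inl
  -- One coordinate at a time suffices; the shift by `i * κ⁻¹` moves coordinate `κ` to `i`.
  refine Subgroup.pi_mem_of_mulSingle_mem f fun i => ?_
  have := inl_cyclicShift_mem (i * κ⁻¹) (hA (hf i))
  rwa [MonoidHom.mulSingle_apply, cyclicShift_mulSingle, inv_mul_cancel_right] at this

/-! ### The two semidirect products inside the wreath product -/

section Alternating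

variable {X : Type} [Fintype X] [DecidableEq X]

/-- The coordinatewise inclusion of the alternating group. -/
def altIncl (X : Type) [Fintype X] [DecidableEq X] :
    Pow5 (alternatingGroup X) →* Pow5 (Equiv.Perm X) where
  toFun f i := f i
  map_one' := rfl
  map_mul' _ _ := rfl

theorem altIncl_apply (f : Pow5 (alternatingGroup X)) (i : Z5) : altIncl X f i = f i := rfl

theorem altIncl_injective : Function.Injective (altIncl X) := fun f g h => by
  funext i
  exact Subtype.ext (congrFun h i)

/-- `A_X ^ 5 ⋊ Z5` inside the wreath product. -/
def ofAltShift (X : Type) [Fintype X] [DecidableEq X] :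
    Pow5 (alternatingGroup X) ⋊[cyclicShift (alternatingGroup X)] Z5 →*
      Wreath5 (Equiv.Perm X) :=
  SemidirectProduct.map (altIncl X) (MonoidHom.id Z5) fun c => by
    ext1 f
    funext i
    change (altIncl X (cyclicShift _ c f)) i = cyclicShift _ c (altIncl X f) i
    simp only [altIncl_apply, cyclicShift_apply]

theorem ofAltShift_injective : Function.Injective (ofAltShift X) := by
  intro g h hgh
  ext1
  · exact altIncl_injective (congrArg SemidirectProduct.left hgh)
  · have := congrArg SemidirectProduct.right hgh
    exact this

theorem range_ofAltShift {a b : Equiv.Perm X} (ha : a ∈ alternatingGroup X)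
    (hb : b ∈ alternatingGroup X)
    (hA : ∀ f : Pow5 (Equiv.Perm X), (∀ i, f i ∈ alternatingGroup X) →
      inl f ∈ twoEntriesClosure a b κ) :
    (ofAltShift X).range = twoEntriesClosure a b κ := by
  apply le_antisymm
  · rintro _ ⟨g, rfl⟩
    rw [← inl_left_mul_inr_right (ofAltShift X g)]
    exact mul_mem (hA _ fun i => (g.left i).2) (inr_mem_twoEntriesClosure _)
  · rw [twoEntriesClosure, Subgroup.closure_le]
    rintro _ (rfl | rfl)
    · refine ⟨inl (twoEntries ⟨a, ha⟩ ⟨b, hb⟩ κ), ?_⟩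
      rw [ofAltShift, SemidirectProduct.map_inl]
      congr 1
      funext i
      rw [altIncl_apply, twoEntries, twoEntries]
      simp only [Pi.mul_apply, Pi.mulSingle_apply]
      split_ifs <;> rfl
    · exact ⟨inr (Multiplicative.ofAdd 1), map_inr ..⟩

variable (τ : Equiv.Perm X) (hτ : τ.IsSwap)

/-- The vector of powers of `τ`, in the base group. -/
def swapVector : (Fin 4 → Z2) →* Pow5 (Equiv.Perm X) where
  toFun v i := ofSwap τ hτ ((evenEquiv v : Pow5 Z2) i)
  map_one' := by funext i; simp
  map_mul' v w := by funext i; simp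

theorem coe_evenEquiv_shift (c : Z5) (v : Fin 4 → Z2) :
    (evenEquiv (shiftZ2Pow4 c v) : Pow5 Z2) = cyclicShift Z2 c (evenEquiv v) := by
  simp [shiftZ2Pow4, evenShift, MulAut.congr]

/-- `Z2 ^ 4 ⋊ Z5` inside the wreath product. -/
def ofZ2Pow4Z5 : Z2Pow4Z5 →* Wreath5 (Equiv.Perm X) :=
  SemidirectProduct.map (swapVector τ hτ) (MonoidHom.id Z5) fun c => by
    ext1 v
    funext i
    change ofSwap τ hτ ((evenEquiv (shiftZ2Pow4 c v) : Pow5 Z2) i) = _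
    rw [coe_evenEquiv_shift]
    rfl

/-- `A_X ^ 5 ⋊ (Z2 ^ 4 ⋊ Z5)` inside the wreath product. -/
def ofAltSwap : Pow5 (alternatingGroup X) ⋊[swapAction τ hτ] Z2Pow4Z5 →*
    Wreath5 (Equiv.Perm X) :=
  SemidirectProduct.lift (inl.comp (altIncl X)) (ofZ2Pow4Z5 τ hτ) fun g => by
    ext1 f
    have h : inl (altIncl X (swapAction τ hτ g f)) * ofZ2Pow4Z5 τ hτ g =
        ofZ2Pow4Z5 τ hτ g * inl (altIncl X f) := by
      ext1
      · funext i
        have e : altIncl X (swapAction τ hτ g f) i =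
            swapVector τ hτ g.left i * altIncl X f (g.right⁻¹ * i) *
              (swapVector τ hτ g.left i)⁻¹ := rfl
        have e2 : (ofZ2Pow4Z5 τ hτ g).left i = swapVector τ hτ g.left i := rfl
        have e3 : (ofZ2Pow4Z5 τ hτ g).right = g.right := rfl
        simp [e, e2, e3, cyclicShift_apply]
      · simp
    simpa using eq_mul_inv_of_mul_eq h

theorem ofAltSwap_left (g : Pow5 (alternatingGroup X) ⋊[swapAction τ hτ] Z2Pow4Z5) (i : Z5) :
    (ofAltSwap τ hτ g).left i =
      g.left i * ofSwap τ hτ ((evenEquiv g.right.left : Pow5 Z2) i) := by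
  rw [← inl_left_mul_inr_right g, map_mul, ofAltSwap, lift_inl, lift_inr]
  simp
  rfl

theorem ofAltSwap_right (g : Pow5 (alternatingGroup X) ⋊[swapAction τ hτ] Z2Pow4Z5) :
    (ofAltSwap τ hτ g).right = g.right.right := by
  rw [← inl_left_mul_inr_right g, map_mul, ofAltSwap, lift_inl, lift_inr]
  simp
  rfl

/-- The isomorphism of `Z2` with the group of signs. -/
def signZ2 : Z2 →* ℤˣ where
  toFun x := (-1) ^ (Multiplicative.toAdd x).val
  map_one' := by decide
  map_mul' := by decide

theorem signZ2_bijective : Function.Bijective signZ2 := by decide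

theorem sign_ofSwap (x : Z2) : Equiv.Perm.sign (ofSwap τ hτ x) = signZ2 x := by
  change Equiv.Perm.sign (τ ^ _) = _
  rw [map_pow, hτ.sign_eq]
  rfl

theorem sign_ofAltSwap_left (g : Pow5 (alternatingGroup X) ⋊[swapAction τ hτ] Z2Pow4Z5) (i : Z5) :
    Equiv.Perm.sign ((ofAltSwap τ hτ g).left i) =
      signZ2 ((evenEquiv g.right.left : Pow5 Z2) i) := by
  rw [ofAltSwap_left, map_mul, sign_ofSwap, (g.left i).2, one_mul]

/-- The signs of the coordinates recover the vector in `Z2 ^ 4`, after which the other components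
can be read off. -/
theorem ofAltSwap_injective : Function.Injective (ofAltSwap τ hτ) := by
  rw [injective_iff_map_eq_one]
  intro g hg
  have hl : (g.right.left : Fin 4 → Z2) = 1 := by
    apply evenEquiv.injective
    apply Subtype.ext
    funext i
    apply signZ2_bijective.1
    rw [← sign_ofAltSwap_left, hg]
    simp
  have hr : g.right.right = 1 := by
    rw [← ofAltSwap_right, hg, one_right]
  ext1
  · funext i
    apply Subtype.ext
    have := ofAltSwap_left τ hτ g i
    rw [hg, hl] at this
    simpa using this.symm
  · ext1
    · exact hl
    · exact hr

/-- Each coordinate is an even permutation times `1` or `τ` according to its sign; the product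
condition says that the resulting exponent vector is even. -/
theorem mem_range_ofAltSwap (g : Wreath5 (Equiv.Perm X)) :
    g ∈ (ofAltSwap τ hτ).range ↔ ∏ i, Equiv.Perm.sign (g.left i) = 1 := by
  constructor
  · rintro ⟨g, rfl⟩
    simp only [sign_ofAltSwap_left, ← map_prod]
    rw [show ∏ i, (evenEquiv g.right.left : Pow5 Z2) i = 1 from (evenEquiv g.right.left).2, map_one]
  · intro hg
    choose v hv using fun i => signZ2_bijective.2 (Equiv.Perm.sign (g.left i))
    have hv1 : v ∈ evenVectors := by
      change ∏ i, v i = 1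
      apply signZ2_bijective.1
      rw [map_prod, map_one, ← hg]
      exact Finset.prod_congr rfl fun i _ => hv i
    refine ⟨⟨fun i => ⟨g.left i * (ofSwap τ hτ (v i))⁻¹, ?_⟩, ⟨evenEquiv.symm ⟨v, hv1⟩, g.right⟩⟩, ?_⟩
    · rw [Equiv.Perm.mem_alternatingGroup, map_mul, map_inv, sign_ofSwap, hv, mul_inv_cancel]
    · ext1
      · funext i
        rw [ofAltSwap_left]
        simp
      · rw [ofAltSwap_right]

theorem prod_sign_twoEntries (a b : Equiv.Perm X) (κ : Z5) :
    ∏ i, Equiv.Perm.sign (twoEntries a b κ i) = Equiv.Perm.sign a * Equiv.Perm.sign b := by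
  simp only [twoEntries, Pi.mul_apply, map_mul, Finset.prod_mul_distrib]
  congr 1 <;> simp [Pi.mulSingle_apply, apply_ite Equiv.Perm.sign]

/-- Every vector of signs with product `1` is the product of a vector and its shift. -/
theorem exists_mul_cyclicShift_eq (hκ : κ ≠ 1) (v : Pow5 ℤˣ) (hv : ∏ i, v i = 1) :
    ∃ m : Pow5 ℤˣ, m * cyclicShift ℤˣ κ m = v := by
  -- Conceptually, the kernel of `m ↦ m * cyclicShift ℤˣ κ m` consists of the constant vectors,
  -- because `κ` generates `Z5`. The image thus has order 16 and is the whole group of vectors of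
  -- product `1`.
  revert κ v
  decide +kernel

theorem range_ofAltSwap {a b : Equiv.Perm X} (ha : Equiv.Perm.sign a = -1)
    (hb : Equiv.Perm.sign b = -1) (hκ : κ ≠ 1)
    (hA : ∀ f : Pow5 (Equiv.Perm X), (∀ i, f i ∈ alternatingGroup X) →
      inl f ∈ twoEntriesClosure a b κ) :
    (ofAltSwap τ hτ).range = twoEntriesClosure a b κ := by
  apply le_antisymm
  · intro g hg
    rw [mem_range_ofAltSwap] at hg
    rw [← inl_left_mul_inr_right g]
    refine mul_mem ?_ (inr_mem_twoEntriesClosure _)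
    obtain ⟨m, hm⟩ := exists_mul_cyclicShift_eq hκ _ hg
    let S : Pow5 (Equiv.Perm X) →* Pow5 ℤˣ := MonoidHom.pi fun i =>
      Equiv.Perm.sign.comp (Pi.evalMonoidHom _ i)
    -- `D` sends the vector with sole entry `-1` at `i` to the sign vector of the `i`-th shift of
    -- `twoEntries a b κ`. So every value of `D` is the sign vector of a base element of the
    -- closure, and dividing `g.left` by such an element leaves even coordinates.
    let D : Pow5 ℤˣ →* Pow5 ℤˣ := MonoidHom.id _ * (cyclicShift ℤˣ κ).toMonoidHom
    have hmem : m ∈ (((twoEntriesClosure a b κ).comap inl).map S).comap D := by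
      refine Subgroup.pi_mem_of_mulSingle_mem m fun i => ?_
      rcases Int.units_eq_one_or (m i) with h | h
      · rw [h, Pi.mulSingle_one]
        exact one_mem _
      · rw [h]
        refine ⟨cyclicShift _ i (twoEntries a b κ), inl_cyclicShift_mem i inl_twoEntries_mem, ?_⟩
        change _ = Pi.mulSingle i (-1) * cyclicShift ℤˣ κ (Pi.mulSingle i (-1))
        rw [cyclicShift_twoEntries, cyclicShift_mulSingle, mul_comm κ i]
        funext j
        change Equiv.Perm.sign ((Pi.mulSingle i a * Pi.mulSingle (i * κ) b : Pow5 (Equiv.Perm X)) j) = _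
        simp only [Pi.mul_apply, map_mul, Pi.mulSingle_apply, apply_ite Equiv.Perm.sign, ha, hb,
          map_one]
    obtain ⟨f, hf, hfm⟩ := hmem
    have hfs : ∀ i, Equiv.Perm.sign (f i) = Equiv.Perm.sign (g.left i) := fun i => by
      have : S f = _ := hfm.trans hm
      exact congrFun this i
    have : g.left = (g.left * f⁻¹) * f := by simp
    rw [this, map_mul]
    refine mul_mem (hA _ fun i => ?_) hf
    rw [Equiv.Perm.mem_alternatingGroup, Pi.mul_apply, Pi.inv_apply, map_mul, map_inv, hfs,
      mul_inv_cancel]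
  · rw [twoEntriesClosure, Subgroup.closure_le]
    rintro _ (rfl | rfl)
    · rw [SetLike.mem_coe, mem_range_ofAltSwap, left_inl, prod_sign_twoEntries, ha, hb]
      decide
    · rw [SetLike.mem_coe, mem_range_ofAltSwap]
      simp

end Alternating

end Wreath5

/-! ### Coordinates on the edges -/

section Coordinates

open SemidirectProduct Wreath5

theorem Equiv.Perm.IsCycleOn.image_of_semiconj {E X : Type*} {f : Equiv.Perm E}
    {g : Equiv.Perm X} {h : E → X} {s : Set E} (hf : f.IsCycleOn s)
    (hg : ∀ x ∈ s, g (h x) = h (f x)) : g.IsCycleOn (h '' s) := by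
  have hpow : ∀ (n : ℕ), ∀ x ∈ s, (g ^ n) (h x) = h ((f ^ n) x) := by
    intro n
    induction n with
    | zero => simp
    | succ k ih =>
      intro x hx
      rw [pow_succ, pow_succ, Equiv.Perm.mul_apply, Equiv.Perm.mul_apply, hg x hx,
        ih _ (hf.apply_mem_iff.2 hx)]
  refine ⟨⟨?_, g.injective.injOn, ?_⟩, ?_⟩
  · rintro _ ⟨x, hx, rfl⟩
    exact ⟨f x, hf.apply_mem_iff.2 hx, (hg x hx).symm⟩
  · rintro _ ⟨x, hx, rfl⟩
    obtain ⟨y, hy, rfl⟩ := hf.1.surjOn hx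
    exact ⟨h y, ⟨y, hy, rfl⟩, hg y hy⟩
  · rintro _ ⟨x, hx, rfl⟩ _ ⟨y, hy, rfl⟩
    obtain ⟨i, hi⟩ := hf.2 hx hy
    obtain ⟨n, rfl | rfl⟩ := i.eq_nat_or_neg
    · exact ⟨n, by rw [zpow_natCast, hpow n x hx, ← zpow_natCast, hi]⟩
    · refine Equiv.Perm.SameCycle.symm ⟨n, ?_⟩
      rw [zpow_natCast, hpow n y hy]
      rw [← hi, zpow_neg, zpow_natCast, ← Equiv.Perm.mul_apply, mul_inv_cancel,
        Equiv.Perm.one_apply]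

variable {E X : Type*} {σ₀ σ₁ : Equiv.Perm E} {wh : E → X} {P Q : Set E}

/-- A permutation whose cycles are the fibres of `wh`, all of size five, is the shift of the second
factor of `X × Z5`, where the points with second coordinate `1` can be prescribed. -/
theorem exists_equiv_prod_of_isCycleOn_fibres (h₁ : ∀ x, σ₁.IsCycleOn {e | wh e = x})
    (h5 : ∀ x, {e | wh e = x}.ncard = 5) (e₀ : X → E) (he₀ : ∀ x, wh (e₀ x) = x) :
    ∃ φ : E ≃ X × Z5, (∀ e, (φ e).1 = wh e) ∧
      (∀ e, φ (σ₁ e) = ((φ e).1, Multiplicative.ofAdd 1 * (φ e).2)) ∧ (∀ x, φ (e₀ x) = (x, 1)) := by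
  have hfin : ∀ x, {e | wh e = x}.Finite := fun x =>
    Set.finite_of_ncard_ne_zero (by rw [h5]; decide)
  have h₁' : ∀ x, σ₁.IsCycleOn ((hfin x).toFinset : Set E) := fun x => by
    rw [Set.Finite.coe_toFinset]; exact h₁ x
  have hcard : ∀ x, (hfin x).toFinset.card = 5 := fun x => by
    rw [← Set.ncard_eq_toFinset_card _ (hfin x), h5]
  have hmem : ∀ x, e₀ x ∈ (hfin x).toFinset := fun x => by simp [he₀]
  have hwh : ∀ (k : ℕ) (e : E), wh ((σ₁ ^ k) e) = wh e := by
    intro k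
    induction k with
    | zero => simp
    | succ k ih =>
      intro e
      rw [pow_succ, Equiv.Perm.mul_apply, ih]
      exact (h₁ (wh e)).apply_mem_iff.2 rfl
  let ψ : X × Z5 → E := fun y => (σ₁ ^ (Multiplicative.toAdd y.2).val) (e₀ y.1)
  have hψ : Function.Bijective ψ := by
    constructor
    · rintro ⟨x, i⟩ ⟨y, j⟩ h
      change (σ₁ ^ (Multiplicative.toAdd i).val) (e₀ x) =
        (σ₁ ^ (Multiplicative.toAdd j).val) (e₀ y) at h
      have hxy : x = y := by
        have := congrArg wh h
        rwa [hwh, hwh, he₀, he₀] at this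
      subst hxy
      rw [(h₁' x).pow_apply_eq_pow_apply (hmem x), hcard] at h
      have : Multiplicative.toAdd i = Multiplicative.toAdd j := by
        rw [← ZMod.natCast_zmod_val (Multiplicative.toAdd i),
          ← ZMod.natCast_zmod_val (Multiplicative.toAdd j)]
        exact (ZMod.natCast_eq_natCast_iff _ _ _).2 h
      rw [Multiplicative.toAdd.injective this]
    · intro e
      obtain ⟨k, hk, he⟩ := (h₁' (wh e)).exists_pow_eq (hmem (wh e)) (b := e) (by simp)
      rw [hcard] at hk
      refine ⟨(wh e, Multiplicative.ofAdd (k : ZMod 5)), ?_⟩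
      change (σ₁ ^ (k : ZMod 5).val) (e₀ (wh e)) = e
      rw [ZMod.val_natCast_of_lt hk, he]
  let φ := (Equiv.ofBijective ψ hψ).symm
  have hφ : ∀ y, φ (ψ y) = y := (Equiv.ofBijective ψ hψ).symm_apply_apply
  refine ⟨φ, fun e => ?_, fun e => ?_, fun x => hφ (x, 1)⟩
  · obtain ⟨y, rfl⟩ := hψ.2 e
    rw [hφ, hwh, he₀]
  · obtain ⟨⟨x, i⟩, rfl⟩ := hψ.2 e
    rw [hφ, show σ₁ (ψ (x, i)) = ψ (x, Multiplicative.ofAdd 1 * i) from ?_, hφ]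
    change (σ₁ ^ 1) ((σ₁ ^ _) _) = (σ₁ ^ _) _
    rw [← Equiv.Perm.mul_apply, ← pow_add, (h₁' x).pow_apply_eq_pow_apply (hmem x), hcard]
    exact (by decide : ∀ i : Z5, 1 + (Multiplicative.toAdd i).val ≡
      (Multiplicative.toAdd (Multiplicative.ofAdd 1 * i)).val [MOD 5]) i

/-- A permutation with two nontrivial cycles `P` and `Q`, each meeting the fibres of `wh` at most
once, with exactly one fibre in common. -/
structure TwoTransversalCycles (σ₀ : Equiv.Perm E) (wh : E → X) (P Q : Set E) (w : X) : Prop where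
  left : σ₀.IsCycleOn P
  right : σ₀.IsCycleOn Q
  fix : ∀ e, e ∉ P → e ∉ Q → σ₀ e = e
  disjoint : Disjoint P Q
  injOn_left : Set.InjOn wh P
  injOn_right : Set.InjOn wh Q
  cover : ∀ x, x ∈ wh '' P ∨ x ∈ wh '' Q
  inter : ∀ x, x ∈ wh '' P ∧ x ∈ wh '' Q ↔ x = w

/-- `k` counts the `σ₁`-steps from the `P`-edge to the `Q`-edge over `w`. Every other fibre meets
only one of `P` and `Q`, so its base edge can be chosen to fit the same `k`; this puts all of `Q` on
one level. -/
theorem TwoTransversalCycles.exists_base {w : X} (h : TwoTransversalCycles σ₀ wh P Q w)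
    (h₁ : ∀ x, σ₁.IsCycleOn {e | wh e = x}) (h5 : ∀ x, {e | wh e = x}.ncard = 5) :
    ∃ (k : ℕ) (e₀ : X → E), (∀ x, wh (e₀ x) = x) ∧ (∀ e ∈ P, e₀ (wh e) = e) ∧
      (∀ e ∈ Q, (σ₁ ^ k) (e₀ (wh e)) = e) := by
  obtain ⟨⟨eP, hP, hPw⟩, eQ, hQ, hQw⟩ := (h.inter w).2 rfl
  obtain ⟨k, hk⟩ := (h₁ w).exists_pow_eq'
    (Set.finite_of_ncard_ne_zero (by rw [h5]; decide)) hPw hQw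
  have hwh : ∀ e, wh ((σ₁ ^ k) e) = wh e := fun e =>
    (h₁ (wh e)).1.mapsTo.perm_pow k (show e ∈ {e' | wh e' = wh e} from rfl)
  have key : ∀ x, ∃ e', wh e' = x ∧ (∀ e ∈ P, wh e = x → e' = e) ∧
      (∀ e ∈ Q, wh e = x → (σ₁ ^ k) e' = e) := by
    intro x
    by_cases hx : x = w
    · subst hx
      refine ⟨eP, hPw, fun e he hex => h.injOn_left hP he (hPw.trans hex.symm), fun e he hex => ?_⟩
      rw [hk]
      exact h.injOn_right hQ he (hQw.trans hex.symm)
    · rcases h.cover x with ⟨e, he, rfl⟩ | ⟨e, he, rfl⟩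
      · exact ⟨e, rfl, fun e' he' hee => h.injOn_left he he' hee.symm, fun e' he' hee =>
          absurd ((h.inter (wh e)).1 ⟨⟨e, he, rfl⟩, e', he', hee⟩) hx⟩
      · refine ⟨(σ₁ ^ k).symm e, ?_, fun e' he' hee => ?_, fun e' he' hee => ?_⟩
        · rw [← hwh, Equiv.apply_symm_apply]
        · exact absurd ((h.inter (wh e)).1 ⟨⟨e', he', hee⟩, e, he, rfl⟩) hx
        · rw [Equiv.apply_symm_apply]
          exact h.injOn_right he he' hee.symm
  choose e₀ h1 h2 h3 using key
  exact ⟨k, e₀, h1, fun e he => h2 _ e he rfl, fun e he => h3 _ e he rfl⟩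

/-- With base edges at level `1`, `P` lies on level `1` and `Q` on level `κ`. Hence `σ₀` preserves
levels and is trivial on all the others. -/
theorem TwoTransversalCycles.exists_coordinates {E : Type*} {X : Type} {σ₀ σ₁ : Equiv.Perm E}
    {wh : E → X} {P Q : Set E} {w : X} (h : TwoTransversalCycles σ₀ wh P Q w)
    (h₁ : ∀ x, σ₁.IsCycleOn {e | wh e = x}) (h5 : ∀ x, {e | wh e = x}.ncard = 5) :
    ∃ (φ : E ≃ X × Z5) (κ : Z5) (a b : Equiv.Perm X), κ ≠ 1 ∧
      CyclesMeetingAt a b (wh '' P) (wh '' Q) w ∧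
      φ.permCongr σ₀ = toPerm X (inl (twoEntries a b κ)) ∧
      φ.permCongr σ₁ = toPerm X (inr (Multiplicative.ofAdd 1)) := by
  obtain ⟨k, e₀, he₀, heP, heQ⟩ := h.exists_base h₁ h5
  obtain ⟨φ, hφ1, hφσ, hφ0⟩ := exists_equiv_prod_of_isCycleOn_fibres h₁ h5 e₀ he₀
  have hφ_pow : ∀ (m : ℕ) (e : E),
      φ ((σ₁ ^ m) e) = ((φ e).1, Multiplicative.ofAdd 1 ^ m * (φ e).2) := by
    intro m
    induction m with
    | zero => simp
    | succ m ih =>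
      intro e
      rw [pow_succ', Equiv.Perm.mul_apply, hφσ, ih, pow_succ', mul_assoc]
  set κ : Z5 := Multiplicative.ofAdd 1 ^ k with hκ
  have hP : ∀ e ∈ P, φ e = (wh e, 1) := fun e he => by rw [← hφ0, heP e he]
  have hQ : ∀ e ∈ Q, φ e = (wh e, κ) := fun e he => by
    conv_lhs => rw [← heQ e he]
    rw [hφ_pow, hφ0, mul_one]
  obtain ⟨⟨eP, hPm, hPw⟩, eQ, hQm, hQw⟩ := (h.inter w).2 rfl
  -- Otherwise the edges of `P` and of `Q` over `w` would have the same coordinates.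
  have hκ1 : κ ≠ 1 := by
    intro hk
    refine Set.disjoint_left.1 h.disjoint hPm ?_
    have : φ eP = φ eQ := by rw [hP _ hPm, hQ _ hQm, hk, hPw, hQw]
    rwa [φ.injective this]
  have hsnd : ∀ e, (φ (σ₀ e)).2 = (φ e).2 := by
    intro e
    by_cases he : e ∈ P
    · rw [hP e he, hP _ (h.left.apply_mem_iff.2 he)]
    · by_cases he' : e ∈ Q
      · rw [hQ e he', hQ _ (h.right.apply_mem_iff.2 he')]
      · rw [h.fix e he he']
  have hsnd' : ∀ e, (φ (σ₀.symm e)).2 = (φ e).2 := fun e => by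
    rw [← hsnd, Equiv.apply_symm_apply]
  -- `F i` is the permutation induced by `σ₀` on level `i`.
  let F : Z5 → Equiv.Perm X := fun i =>
    { toFun := fun x => (φ (σ₀ (φ.symm (x, i)))).1
      invFun := fun x => (φ (σ₀.symm (φ.symm (x, i)))).1
      left_inv := fun x => by
        have : ((φ (σ₀ (φ.symm (x, i)))).1, i) = φ (σ₀ (φ.symm (x, i))) := by
          ext1
          · rfl
          · simp [hsnd]
        simp only [this, φ.symm_apply_apply, Equiv.symm_apply_apply, φ.apply_symm_apply]
      right_inv := fun x => by
        have : ((φ (σ₀.symm (φ.symm (x, i)))).1, i) = φ (σ₀.symm (φ.symm (x, i))) := by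
          ext1
          · rfl
          · simp [hsnd']
        simp only [this, φ.symm_apply_apply, Equiv.apply_symm_apply, φ.apply_symm_apply] }
  have hF : ∀ i x, F i x = (φ (σ₀ (φ.symm (x, i)))).1 := fun _ _ => rfl
  have hFfix : ∀ i x, φ.symm (x, i) ∉ P → φ.symm (x, i) ∉ Q → F i x = x := fun i x h1 h2 => by
    rw [hF, h.fix _ h1 h2, φ.apply_symm_apply]
  have hnP : ∀ i x, i ≠ 1 → φ.symm (x, i) ∉ P := fun i x hi he => by
    have := congrArg Prod.snd (hP _ he)
    rw [φ.apply_symm_apply] at this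
    exact hi this
  have hnQ : ∀ i x, i ≠ κ → φ.symm (x, i) ∉ Q := fun i x hi he => by
    have := congrArg Prod.snd (hQ _ he)
    rw [φ.apply_symm_apply] at this
    exact hi this
  have hF2 : F = twoEntries (F 1) (F κ) κ := by
    funext i
    rcases eq_or_ne i 1 with rfl | h1
    · simp [twoEntries, hκ1.symm]
    · rcases eq_or_ne i κ with rfl | h2
      · rw [twoEntries_apply_right hκ1]
      · ext x
        rw [hFfix i x (hnP i x h1) (hnQ i x h2)]
        simp [twoEntries, h1, h2]
  refine ⟨φ, κ, F 1, F κ, hκ1, ⟨?_, ?_, ?_, ?_, h.cover, h.inter⟩, ?_, ?_⟩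
  · refine h.left.image_of_semiconj fun e he => ?_
    rw [hF, ← hP e he, φ.symm_apply_apply, hφ1]
  · refine h.right.image_of_semiconj fun e he => ?_
    rw [hF, ← hQ e he, φ.symm_apply_apply, hφ1]
  · intro x hx
    refine hFfix 1 x (fun he => hx ⟨_, he, ?_⟩) (hnQ 1 x hκ1.symm)
    rw [← hφ1, φ.apply_symm_apply]
  · intro x hx
    refine hFfix κ x (hnP κ x hκ1) (fun he => hx ⟨_, he, ?_⟩)
    rw [← hφ1, φ.apply_symm_apply]
  · rw [← hF2]
    ext1 ⟨x, i⟩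
    rw [toPerm_apply, left_inl, right_inl, one_mul, Equiv.permCongr_apply]
    ext1
    · rfl
    · simp [hsnd]
  · ext1 y
    rw [toPerm_apply, left_inr, right_inr, Equiv.permCongr_apply, hφσ, φ.apply_symm_apply]
    rfl

/-- The group generated by two permutations is the subgroup `twoEntriesClosure` of the wreath
product, if they are its two generators in suitable coordinates. -/
theorem nonempty_closure_equiv {E F : Type*} {X : Type} [Nonempty X] {σ₀ σ₁ : Equiv.Perm E}
    {a b : Equiv.Perm X} {κ : Z5} (φ : E ≃ X × Z5)
    (h₀ : φ.permCongr σ₀ = toPerm X (inl (twoEntries a b κ)))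
    (h₁ : φ.permCongr σ₁ = toPerm X (inr (Multiplicative.ofAdd 1))) (l : E ≃ F) :
    Nonempty (Subgroup.closure {l.permCongr σ₀, l.permCongr σ₁} ≃* twoEntriesClosure a b κ) := by
  let Θ : Wreath5 (Equiv.Perm X) →* Equiv.Perm F :=
    ((φ.symm.trans l).permCongrHom.toMonoidHom).comp (toPerm X)
  have hΘ : Function.Injective Θ :=
    (φ.symm.trans l).permCongrHom.injective.comp (toPerm_injective X)
  have hΘ' : ∀ (σ : Equiv.Perm E) g, φ.permCongr σ = toPerm X g → Θ g = l.permCongr σ := by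
    intro σ g hg
    change (φ.symm.trans l).permCongr (toPerm X g) = _
    rw [← hg]
    ext y
    simp [Equiv.permCongr_apply]
  have hmap : (twoEntriesClosure a b κ).map Θ =
      Subgroup.closure {l.permCongr σ₀, l.permCongr σ₁} := by
    rw [twoEntriesClosure, MonoidHom.map_closure, Set.image_pair, hΘ' _ _ h₀, hΘ' _ _ h₁]
  rw [← hmap]
  exact ⟨((twoEntriesClosure a b κ).equivMapOfInjective Θ hΘ).symm⟩

end Coordinates

/-! ### Combinatorics of the tree: hubs, leaves and white vertices. -/

namespace BicolouredPlaneTree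

variable {V : Type*} (T : BicolouredPlaneTree V)

theorem ncard_edges_eq_degree (v : V) [Fintype (T.graph.neighborSet v)] :
    {e : T.graph.edgeSet | v ∈ (e : Sym2 V)}.ncard = T.graph.degree v := by
  classical
  rw [← Set.ncard_image_of_injective _ Subtype.val_injective,
    ← SimpleGraph.card_incidenceSet_eq_degree, ← Nat.card_eq_fintype_card,
    Nat.card_coe_set_eq]
  congr 1
  ext e
  simp [SimpleGraph.incidenceSet]
  tauto

theorem exists_black_white (e : T.graph.edgeSet) :
    ∃ x y, T.IsBlack x ∧ ¬ T.IsBlack y ∧ (e : Sym2 V) = s(x, y) := by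
  obtain ⟨e, he⟩ := e
  induction e with
  | _ x y =>
    have h := T.proper x y he
    by_cases hx : T.IsBlack x
    · exact ⟨x, y, hx, h.1 hx, rfl⟩
    · exact ⟨y, x, by tauto, hx, Sym2.eq_swap⟩

theorem eq_of_black_mem {e : T.graph.edgeSet} {x y : V} (hx : T.IsBlack x) (hy : T.IsBlack y)
    (hxe : x ∈ (e : Sym2 V)) (hye : y ∈ (e : Sym2 V)) : x = y := by
  obtain ⟨a, b, ha, hb, he⟩ := T.exists_black_white e
  rw [he, Sym2.mem_iff] at hxe hye
  have h1 : x ≠ b := by rintro rfl; exact hb hx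
  have h2 : y ≠ b := by rintro rfl; exact hb hy
  rw [hxe.resolve_right h1, hye.resolve_right h2]

theorem eq_of_white_mem {e : T.graph.edgeSet} {x y : V} (hx : ¬ T.IsBlack x) (hy : ¬ T.IsBlack y)
    (hxe : x ∈ (e : Sym2 V)) (hye : y ∈ (e : Sym2 V)) : x = y := by
  obtain ⟨a, b, ha, hb, he⟩ := T.exists_black_white e
  rw [he, Sym2.mem_iff] at hxe hye
  have h1 : x ≠ a := by rintro rfl; exact hx ha
  have h2 : y ≠ a := by rintro rfl; exact hy ha
  rw [hxe.resolve_left h1, hye.resolve_left h2]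

theorem eq_of_mem_of_mem {e e' : T.graph.edgeSet} {x y : V} (hx : T.IsBlack x)
    (hy : ¬ T.IsBlack y) (hxe : x ∈ (e : Sym2 V)) (hye : y ∈ (e : Sym2 V))
    (hxe' : x ∈ (e' : Sym2 V)) (hye' : y ∈ (e' : Sym2 V)) : e = e' := by
  have hxy : x ≠ y := by rintro rfl; exact hy hx
  apply Subtype.ext
  rw [(Sym2.mem_and_mem_iff hxy).1 ⟨hxe, hye⟩, (Sym2.mem_and_mem_iff hxy).1 ⟨hxe', hye'⟩]

theorem mem_of_adj_closed {S : Set V} {x : V} (hx : x ∈ S)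
    (hS : ∀ y z, y ∈ S → T.graph.Adj y z → z ∈ S) (v : V) : v ∈ S := by
  obtain ⟨p⟩ := T.isTree.connected.preconnected x v
  induction p with
  | nil => exact hx
  | cons h _ ih => exact ih (hS _ _ hx h)

/-- If every black vertex other than `u` and `v` is a leaf, then every white vertex is joined to
`u` or `v`. -/
theorem exists_edge_to_hub {u v : V} (hu : T.IsBlack u)
    (h1 : ∀ x, T.IsBlack x → x ≠ u → x ≠ v →
      {e : T.graph.edgeSet | x ∈ (e : Sym2 V)}.ncard = 1) {y : V} (hy : ¬ T.IsBlack y) :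
    ∃ e : T.graph.edgeSet, y ∈ (e : Sym2 V) ∧ (u ∈ (e : Sym2 V) ∨ v ∈ (e : Sym2 V)) := by
  by_contra! hne
  -- If `y` misses both hubs, all its neighbours are leaves, so `y` and its neighbours are closed
  -- under adjacency; connectedness would put `u` among them.
  have hmem : u ∈ ({z | z = y ∨ T.graph.Adj y z} : Set V) := by
    refine T.mem_of_adj_closed (x := y) (Or.inl rfl) ?_ u
    rintro z t (rfl | hyz) hzt
    · exact Or.inr hzt
    · left
      have hz : T.IsBlack z := by
        have := T.proper y z hyz
        tauto
      have hzu : z ≠ u := by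
        rintro rfl
        exact (hne ⟨s(y, z), hyz⟩ (by simp)).1 (by simp)
      have hzv : z ≠ v := by
        rintro rfl
        exact (hne ⟨s(y, z), hyz⟩ (by simp)).2 (by simp)
      obtain ⟨e, he⟩ := Set.ncard_eq_one.1 (h1 z hz hzu hzv)
      have e1 : (⟨s(y, z), hyz⟩ : T.graph.edgeSet) = e := by
        rw [← Set.mem_singleton_iff, ← he]
        simp
      have e2 : (⟨s(z, t), hzt⟩ : T.graph.edgeSet) = e := by
        rw [← Set.mem_singleton_iff, ← he]
        simp
      have e3 : s(y, z) = s(z, t) := congrArg Subtype.val (e1.trans e2.symm)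
      rw [Sym2.eq_swap, Sym2.congr_right] at e3
      exact e3.symm
  rcases hmem with rfl | hadj
  · exact hy hu
  · exact (hne ⟨s(y, u), hadj⟩ (by simp)).1 (by simp)

theorem exists_hubs [Fintype V] {r s : ℕ}
    (hT : T.blackDegrees = Multiset.replicate 2 r + Multiset.replicate s 1) :
    ∃ u v, u ≠ v ∧ T.IsBlack u ∧ T.IsBlack v ∧
      {e : T.graph.edgeSet | u ∈ (e : Sym2 V)}.ncard = r ∧
      {e : T.graph.edgeSet | v ∈ (e : Sym2 V)}.ncard = r ∧
      ∀ x, T.IsBlack x → x ≠ u → x ≠ v →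
        {e : T.graph.edgeSet | x ∈ (e : Sym2 V)}.ncard = 1 := by
  classical
  have h2 : (Multiset.replicate 2 r + Multiset.replicate s 1 : Multiset ℕ) =
      r ::ₘ r ::ₘ Multiset.replicate s 1 := rfl
  unfold blackDegrees at hT
  rw [h2, ← Multiset.map_eq_cons] at hT
  obtain ⟨u, hu, hur, hT⟩ := hT
  rw [← Multiset.map_eq_cons] at hT
  obtain ⟨v, hv, hvr, hT⟩ := hT
  have hnd := Finset.nodup (Finset.univ.filter fun v => T.IsBlack v)
  have hnd' := hnd.erase u
  rw [hnd.mem_erase_iff] at hv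
  have huB : T.IsBlack u := by simpa using hu
  have hvB : T.IsBlack v := by simpa using hv.2
  refine ⟨u, v, hv.1.symm, huB, hvB, ?_, ?_, fun x hx hxu hxv => ?_⟩
  · rw [ncard_edges_eq_degree]; exact hur
  · rw [ncard_edges_eq_degree]; exact hvr
  · rw [ncard_edges_eq_degree]
    apply Multiset.eq_of_mem_replicate (n := s)
    rw [← hT]
    refine Multiset.mem_map_of_mem _ ?_
    rw [hnd'.mem_erase_iff, hnd.mem_erase_iff]
    exact ⟨hxv, hxu, by simpa using hx⟩

theorem exists_white_enumeration [Fintype V] {p d : ℕ}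
    (hT : T.whiteDegrees = Multiset.replicate p d) :
    Nonempty (Fin p ≃ {y // ¬ T.IsBlack y}) ∧ ∀ y, ¬ T.IsBlack y →
      {e : T.graph.edgeSet | y ∈ (e : Sym2 V)}.ncard = d := by
  classical
  unfold whiteDegrees at hT
  constructor
  · have h := congrArg Multiset.card hT
    rw [Multiset.card_map, Finset.card_val, Multiset.card_replicate,
      ← Fintype.card_subtype] at h
    exact ⟨(Fintype.equivFinOfCardEq (by convert h)).symm⟩
  · intro y hy
    rw [ncard_edges_eq_degree]
    apply Multiset.eq_of_mem_replicate (n := p)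
    rw [← hT]
    exact Multiset.mem_map_of_mem _ (by simpa using hy)

/-- `wh` gives the white end of an edge, and `P`, `Q` are the edges at the two hubs. A black vertex
and a white one share at most one edge, whence injectivity; inclusion–exclusion gives `2 * r - p =
1` common white neighbour. -/
theorem exists_twoTransversalCycles [Fintype V] {r s p n : ℕ} (hpr : p + 1 = 2 * r)
    (hT : T.HasPassport (Multiset.replicate 2 r + Multiset.replicate s 1)
      (Multiset.replicate p 5) n) :
    ∃ (wh : T.graph.edgeSet → Fin p) (P Q : Set T.graph.edgeSet) (w : Fin p),
      TwoTransversalCycles T.σ₀ wh P Q w ∧ (∀ x, T.σ₁.IsCycleOn {e | wh e = x}) ∧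
      (∀ x, {e | wh e = x}.ncard = 5) ∧ (wh '' P).ncard = r ∧ (wh '' Q).ncard = r := by
  classical
  obtain ⟨u, v, huv, hu, hv, hur, hvr, hleaf⟩ := T.exists_hubs hT.1
  obtain ⟨⟨ω⟩, hdeg⟩ := T.exists_white_enumeration hT.2.1
  have hex : ∀ e : T.graph.edgeSet, ∃ x : Fin p, ∀ y, y = x ↔ (ω y : V) ∈ (e : Sym2 V) := by
    intro e
    obtain ⟨a, b, ha, hb, he⟩ := T.exists_black_white e
    have hbe : b ∈ (e : Sym2 V) := by rw [he]; simp
    refine ⟨ω.symm ⟨b, hb⟩, fun y => ⟨?_, fun hy => ?_⟩⟩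
    · rintro rfl
      rwa [Equiv.apply_symm_apply]
    · rw [Equiv.eq_symm_apply]
      exact Subtype.ext (T.eq_of_white_mem (ω y).2 hb hy hbe)
  choose wh hwh using hex
  have hfib : ∀ x, {e | wh e = x} = {e : T.graph.edgeSet | (ω x : V) ∈ (e : Sym2 V)} := by
    intro x
    ext e
    exact eq_comm.trans (hwh e x)
  have hmem : ∀ e : T.graph.edgeSet, (ω (wh e) : V) ∈ (e : Sym2 V) := fun e => (hwh e _).1 rfl
  have hinj : ∀ z, T.IsBlack z → Set.InjOn wh {e | z ∈ (e : Sym2 V)} := by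
    intro z hz e he e' he' hee
    refine T.eq_of_mem_of_mem hz (ω (wh e)).2 he (hmem e) he' ?_
    rw [hee]
    exact hmem e'
  set P := {e : T.graph.edgeSet | u ∈ (e : Sym2 V)} with hP
  set Q := {e : T.graph.edgeSet | v ∈ (e : Sym2 V)} with hQ
  have hPr : (wh '' P).ncard = r := by rw [(hinj u hu).ncard_image, hur]
  have hQr : (wh '' Q).ncard = r := by rw [(hinj v hv).ncard_image, hvr]
  have hcover : ∀ x, x ∈ wh '' P ∨ x ∈ wh '' Q := by
    intro x
    obtain ⟨e, he, h⟩ := T.exists_edge_to_hub hu hleaf (ω x).2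
    have hx := (hwh e x).2 he
    exact h.imp (fun h => ⟨e, h, hx.symm⟩) fun h => ⟨e, h, hx.symm⟩
  have hone : (wh '' P ∩ wh '' Q).ncard = 1 := by
    have h := Set.ncard_union_add_ncard_inter (wh '' P) (wh '' Q)
    rw [hPr, hQr, Set.eq_univ_of_forall (s := wh '' P ∪ wh '' Q) hcover, Set.ncard_univ,
      Nat.card_eq_fintype_card, Fintype.card_fin] at h
    omega
  obtain ⟨w, hw⟩ := Set.ncard_eq_one.1 hone
  refine ⟨wh, P, Q, w, ⟨T.cyclic_black u hu, T.cyclic_black v hv, ?_, ?_, hinj u hu, hinj v hv,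
    hcover, fun x => by rw [← Set.mem_inter_iff, hw, Set.mem_singleton_iff]⟩, ?_, ?_, hPr, hQr⟩
  · intro e heP heQ
    obtain ⟨a, b, ha, hb, he⟩ := T.exists_black_white e
    have hae : a ∈ (e : Sym2 V) := by rw [he]; simp
    have hau : a ≠ u := by rintro rfl; exact heP hae
    have hav : a ≠ v := by rintro rfl; exact heQ hae
    -- The black end is a leaf, and `σ₀` permutes the edges at it, of which there is only one.
    obtain ⟨e', he'⟩ := Set.ncard_eq_one.1 (hleaf a ha hau hav)
    have h1 : T.σ₀ e ∈ {e : T.graph.edgeSet | a ∈ (e : Sym2 V)} :=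
      (T.cyclic_black a ha).apply_mem_iff.2 hae
    have h2 : e ∈ {e : T.graph.edgeSet | a ∈ (e : Sym2 V)} := hae
    rw [he', Set.mem_singleton_iff] at h1 h2
    rw [h1, h2]
  · exact Set.disjoint_left.2 fun e h1 h2 => huv (T.eq_of_black_mem hu hv h1 h2)
  · intro x
    rw [hfib]
    exact T.cyclic_white _ (ω x).2
  · intro x
    rw [hfib]
    exact hdeg _ (ω x).2

end BicolouredPlaneTree

/-! ### The main theorem. -/

open Wreath5 in
theorem mainTheorem7 (r s p n : ℕ) (hn : n = 5 * p) (hrs : n = 2 * r + s)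
    (hp : p + s + 2 = n + 1) {V : Type*} [Fintype V] (T : BicolouredPlaneTree V)
    (hT : T.HasPassport (Multiset.replicate 2 r + Multiset.replicate s 1)
      (Multiset.replicate p 5) n)
    (l : T.graph.edgeSet ≃ Fin n) :
    (Odd r → Nonempty (T.monodromyGroup l ≃*
      Pow5 (alternatingGroup (Fin p)) ⋊[cyclicShift (alternatingGroup (Fin p))] Z5)) ∧
    (Even r → ∃ (τ : Equiv.Perm (Fin p)) (hτ : τ.IsSwap), Nonempty (T.monodromyGroup l ≃*
      Pow5 (alternatingGroup (Fin p)) ⋊[swapAction τ hτ] Z2Pow4Z5)) := by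
  have hpr : p + 1 = 2 * r := by omega
  obtain ⟨wh, P, Q, w, hPQ, h₁, h5, hPr, hQr⟩ := T.exists_twoTransversalCycles hpr hT
  obtain ⟨φ, κ, a, b, hκ, hab, h₀', h₁'⟩ := hPQ.exists_coordinates h₁ h5
  have : Nonempty (Fin p) := ⟨w⟩
  obtain ⟨μ⟩ := nonempty_closure_equiv φ h₀' h₁' l
  generalize hU : wh '' P = U at hab hPr
  generalize hV : wh '' Q = W at hab hQr
  have hK : ∀ K : Subgroup (Equiv.Perm (Fin p)), (∀ g ∈ K, a * g * a⁻¹ ∈ K) →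
      (∀ g ∈ K, b * g * b⁻¹ ∈ K) → a * b * a⁻¹ * b⁻¹ ∈ K → alternatingGroup (Fin p) ≤ K := by
    intro K h1 h2 h3
    -- For `r = 1` the cycles are trivial and there is no 3-cycle, but then `p = 1` and the
    -- alternating group is trivial too.
    by_cases hr : r = 1
    · have : p = 1 := by omega
      subst this
      intro g _
      rw [Subsingleton.elim g 1]
      exact one_mem K
    · have hnt : ∀ S : Set (Fin p), S.ncard = r → S.Nontrivial := fun S hS => by
        rw [← Set.one_lt_ncard_iff_nontrivial]
        omega
      exact hab.alternatingGroup_le (hnt _ hPr) (hnt _ hQr)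
        (by rw [Nat.card_eq_fintype_card, Fintype.card_fin]; exact ⟨r - 1, by omega⟩) h1 h2 h3
  have hA := inl_mem_twoEntriesClosure_of_alternating hκ hK
  have hsign : Equiv.Perm.sign a = -(-1) ^ r ∧ Equiv.Perm.sign b = -(-1) ^ r := by
    lift U to Finset (Fin p) using U.toFinite
    lift W to Finset (Fin p) using W.toFinite
    rw [Set.ncard_coe_finset] at hPr hQr
    refine ⟨?_, ?_⟩
    · rw [hab.left.sign_eq ⟨w, hab.mem_left⟩ hab.left_fix, hPr]
    · rw [hab.right.sign_eq ⟨w, hab.mem_right⟩ hab.right_fix, hQr]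
  constructor
  · intro hr
    rw [hr.neg_one_pow, neg_neg] at hsign
    refine ⟨μ.trans ((MulEquiv.subgroupCongr (range_ofAltShift hsign.1 hsign.2 hA).symm).trans
      (MonoidHom.ofInjective ofAltShift_injective).symm)⟩
  · intro hr
    rw [hr.neg_one_pow] at hsign
    -- An even `r` with `p + 1 = 2 * r` is at least 2, so `p ≥ 3` and a transposition exists.
    have h2 : 1 < p := by
      obtain ⟨k, rfl⟩ := hr
      omega
    let τ : Equiv.Perm (Fin p) := Equiv.swap ⟨0, by omega⟩ ⟨1, h2⟩
    have hτ : τ.IsSwap := ⟨_, _, by simp, rfl⟩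
    exact ⟨τ, hτ, ⟨μ.trans ((MulEquiv.subgroupCongr
      (range_ofAltSwap τ hτ hsign.1 hsign.2 hκ hA).symm).trans
      (MonoidHom.ofInjective (ofAltSwap_injective τ hτ)).symm)⟩⟩
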